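/- Let $m\ge 1$ and let $S_j(x)=\rho x+d_j$ ($j=0,\dots,m$) be pairwise distinct similarities of $\mathbb{R}$ with a common contraction factor $0<\rho<1$ whose self-similar set (the unique non-empty compact $K$ with $K=\bigcup_j S_j(K)$) is $K=[0,1]$. Assume that the system is of finite type: there is a finite set $F\subset\mathbb{R}$ such that for all $n$ and all words $v,w$ of length $n$ over $\{0,\dots,m\}$, either $|S_v(0)-S_w(0)|>\operatorname{diam}(K)\,\rho^{n}$ or $\rho^{-n}|S_v(0)-S_w(0)|\in F$, where $S_{j_1\cdots j_n}=S_{j_1}\circ\dots\circ S_{j_n}$. Let $p_j>0$ with $\sum_j p_j=1$, and assume regularity: the probabilities attached to the left-most and the right-most of the maps $S_j$ are equal and are minimal among all $p_j$. Let $\mu$ be the associated self-similar measure, i.e. the Borel probability measure on $\mathbb{R}$ with $\mu(E)=\sum_j p_j\,\mu(S_j^{-1}(E))$ for all Borel sets $E$. A dimension function is a map $\Phi:(0,1)\to[0,\infty)$ such that $x^{1+\Phi(x)}$ decreases to $0$ as $x$ decreases to $0$. The upper $\Phi$-dimension $\overline{\dim}_\Phi\mu$ is the infimum of all $\alpha\in\mathbb{R}$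 for which there are $C_1,C_2>0$ such that $$\frac{\mu(B(x,R))}{\mu(B(x,r))}\le C_2\Big(\frac{R}{r}\Big)^{\alpha}\qquad\text{for all }x\in\operatorname{supp}\mu\text{ and all }0<r<R^{1+\Phi(R)}\le R\le C_1,\ R<1,$$ where $B(x,R)$ denotes the open ball (and $\inf\emptyset=\infty$). Then $\overline{\dim}_\Phi\mu$ is finite for every dimension function $\Phi$ for which there is a constant $c>0$ with $$\frac{\log|\log x|}{|\log x|}\le c\,\Phi(x)\qquad\text{for all }x\in(0,1).$$ In particular, the quasi-Assouad dimension $\dim_{qA}\mu=\lim_{\theta\to1^-}\overline{\dim}_{\Phi_\theta}\mu$, where $\Phi_\theta$ is the constant function $1/\theta-1$, exists and is finite. -/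

import Mathlib

open Set Filter Topology MeasureTheory

namespace PhiDim

noncomputable section

/-! ### Dimension functions and dimensions of measures -/

/-- A dimension function: `Φ ≥ 0` on `(0,1)` and `x ^ (1 + Φ x)` decreases to `0` as `x`
decreases to `0`. Only the values of `Φ` on `(0,1)` matter. -/
structure IsDimensionFunction (Φ : ℝ → ℝ) : Prop where
  nonneg : ∀ x ∈ Ioo (0 : ℝ) 1, 0 ≤ Φ x
  monotoneOn : MonotoneOn (fun x : ℝ => x ^ (1 + Φ x)) (Ioo 0 1)
  tendsto_zero : Tendsto (fun x : ℝ => x ^ (1 + Φ x)) (𝓝[>] 0) (𝓝 0)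

/-- `f ⪯ g` on `s`: there is a constant `c` with `f x ≤ c * g x` for all `x ∈ s`. -/
def DominatedOn (f g : ℝ → ℝ) (s : Set ℝ) : Prop :=
  ∃ c : ℝ, 0 < c ∧ ∀ x ∈ s, f x ≤ c * g x

/-- The set of exponents `α` admissible in the definition of the upper `Φ`-dimension of `μ`. -/
def upperPhiExponents {X : Type*} [PseudoMetricSpace X] [MeasurableSpace X]
    (Φ : ℝ → ℝ) (μ : Measure X) : Set ℝ :=
  {α : ℝ | ∃ C₁ C₂ : ℝ, 0 < C₁ ∧ 0 < C₂ ∧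
    ∀ r R : ℝ, 0 < r → r < R ^ (1 + Φ R) → R ^ (1 + Φ R) ≤ R → R ∈ Ioo (0 : ℝ) 1 → R ≤ C₁ →
      ∀ x ∈ μ.support,
        μ.real (Metric.ball x R) / μ.real (Metric.ball x r) ≤ C₂ * (R / r) ^ α}

/-- The upper `Φ`-dimension of `μ`, an extended real number (`⊤` if no exponent is admissible). -/
def upperPhiDim {X : Type*} [PseudoMetricSpace X] [MeasurableSpace X]
    (Φ : ℝ → ℝ) (μ : Measure X) : EReal :=
  sInf ((fun α : ℝ => (α : EReal)) '' upperPhiExponents Φ μ)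

/-- `t` is the (upper) quasi-Assouad dimension of `μ`, that is, the limit as `θ → 1`, `θ < 1`,
of the upper dimensions of `μ` with respect to the constant functions `1 / θ - 1`. -/
def HasQuasiAssouadDim {X : Type*} [PseudoMetricSpace X] [MeasurableSpace X]
    (μ : Measure X) (t : EReal) : Prop :=
  Tendsto (fun θ : ℝ => upperPhiDim (fun _ => 1 / θ - 1) μ) (𝓝[<] 1) (𝓝 t)

/-! ### Equicontractive iterated function systems on the line -/

/-- The similarity `S_j x = ρ x + d_j`. -/
def simMap {m : ℕ} (ρ : ℝ) (d : Fin (m + 1) → ℝ) (j : Fin (m + 1)) (x : ℝ) : ℝ :=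
  ρ * x + d j

/-- `S_w = S_{j₁} ∘ ⋯ ∘ S_{jₙ}` for the word `w = [j₁, …, jₙ]`. -/
def wordMap {m : ℕ} (ρ : ℝ) (d : Fin (m + 1) → ℝ) : List (Fin (m + 1)) → ℝ → ℝ
  | [], x => x
  | j :: w, x => simMap ρ d j (wordMap ρ d w x)

/-- `K` is the self-similar set of the system: nonempty, compact and `K = ⋃ j, S_j(K)`. -/
def IsSelfSimilarSet {m : ℕ} (ρ : ℝ) (d : Fin (m + 1) → ℝ) (K : Set ℝ) : Prop :=
  K.Nonempty ∧ IsCompact K ∧ K = ⋃ j, simMap ρ d j '' K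

/-- Finite type, for a system with self-similar set `K`. -/
def IsFiniteType {m : ℕ} (ρ : ℝ) (d : Fin (m + 1) → ℝ) (K : Set ℝ) : Prop :=
  ∃ F : Set ℝ, F.Finite ∧ ∀ (n : ℕ) (v w : List (Fin (m + 1))), v.length = n → w.length = n →
    Metric.diam K * ρ ^ n < |wordMap ρ d v 0 - wordMap ρ d w 0| ∨
      (ρ ^ n)⁻¹ * |wordMap ρ d v 0 - wordMap ρ d w 0| ∈ F

/-- Regularity: the probabilities of the left-most and of the right-most contraction are equal
and minimal. -/
def IsRegular {m : ℕ} (d p : Fin (m + 1) → ℝ) : Prop :=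
  ∃ a b : Fin (m + 1), (∀ j, d a ≤ d j) ∧ (∀ j, d j ≤ d b) ∧ p a = p b ∧ ∀ j, p a ≤ p j

/-- `μ` is self-similar: `μ(E) = ∑ j, p_j μ(S_j⁻¹(E))` for all Borel sets `E`. -/
def IsSelfSimilarMeasure {m : ℕ} (ρ : ℝ) (d p : Fin (m + 1) → ℝ) (μ : Measure ℝ) : Prop :=
  ∀ E : Set ℝ, MeasurableSet E → μ E = ∑ j, ENNReal.ofReal (p j) * μ (simMap ρ d j ⁻¹' E)

end

end PhiDim

/-! Let `q` be the common probability of the two extreme maps and W_n(x) the total weight of the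
words `w` of length `n` with x ∈ S_w[0,1). Iterating self-similarity, the mass of the closed ball of
radius ρ^n about x is at least W_n(x) and at most a sum of four values W_n(z) with |z - x| ≤ 2ρ^n.
So everything rests on comparing W_n at nearby points.

W_n is a step function that jumps only at end points of the intervals S_w[0,1], and finite type
bounds the number of these in an interval of length ρ^n, uniformly in `n`
(`exists_card_coverEndpoints_le`). Across an end point in (0,1) the one-sided limits differ by a
factor of at most 1 + n/q (`coverWeight_Ioc_le` and its mirror image): by regularity each new level
adds an error of at most q^n, while covering forces W_{n+1} ≥ q^{n+1}, so the errors add up instead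
of multiplying. Crossing boundedly many jumps (`step_comparable`) costs a factor polynomial in `n`.

Since W_{n+k} ≥ q^k W_n, this gives μ(B(x,R)) ≤ C |log R|^K (R/r)^s μ(B(x,r)) with ρ^s = q
(`exists_real_ball_le`). The condition r < R^(1+Φ(R)) means R/r > exp(Φ(R)|log R|), so the
domination hypothesis turns |log R|^K into at most (R/r)^(cK). For a positive constant Φ the
logarithmic power is O(R/r), so the exponent s + 1 serves every θ, and monotonicity in θ gives the
limit. -/

namespace PhiDim

/-! ### The transfer operator -/

/-- The operator `g ↦ ∑ j, p_j • g ∘ S_j⁻¹`. -/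
noncomputable def transfer {m : ℕ} (ρ : ℝ) (d p : Fin (m + 1) → ℝ) (g : ℝ → ℝ) (x : ℝ) : ℝ :=
  ∑ j, p j * g ((x - d j) / ρ)

/-- The total weight of the words `w` of length `n` with `x ∈ S_w(s)`. -/
noncomputable def coverWeight {m : ℕ} (ρ : ℝ) (d p : Fin (m + 1) → ℝ) (s : Set ℝ) (n : ℕ) :
    ℝ → ℝ :=
  (transfer ρ d p)^[n] (s.indicator 1)

section Transfer

variable {m : ℕ} {ρ : ℝ} {d p : Fin (m + 1) → ℝ}

theorem transfer_iterate_succ (g : ℝ → ℝ) (n : ℕ) (x : ℝ) :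
    (transfer ρ d p)^[n + 1] g x = ∑ j, p j * (transfer ρ d p)^[n] g ((x - d j) / ρ) := by
  rw [Function.iterate_succ_apply', transfer]

theorem coverWeight_zero (s : Set ℝ) (x : ℝ) :
    coverWeight ρ d p s 0 x = s.indicator 1 x := rfl

theorem coverWeight_succ (s : Set ℝ) (n : ℕ) (x : ℝ) :
    coverWeight ρ d p s (n + 1) x = ∑ j, p j * coverWeight ρ d p s n ((x - d j) / ρ) :=
  transfer_iterate_succ _ _ _

theorem transfer_iterate_mono (hp : ∀ j, 0 ≤ p j) {g h : ℝ → ℝ} (hgh : ∀ x, g x ≤ h x) (n : ℕ)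
    (x : ℝ) : (transfer ρ d p)^[n] g x ≤ (transfer ρ d p)^[n] h x := by
  induction n generalizing x with
  | zero => exact hgh x
  | succ n ih =>
    rw [transfer_iterate_succ, transfer_iterate_succ]
    exact Finset.sum_le_sum fun j _ => mul_le_mul_of_nonneg_left (ih _) (hp j)

theorem transfer_iterate_const_mul (c : ℝ) (g : ℝ → ℝ) (n : ℕ) (x : ℝ) :
    (transfer ρ d p)^[n] (fun y => c * g y) x = c * (transfer ρ d p)^[n] g x := by
  induction n generalizing x with
  | zero => rfl
  | succ n ih =>
    rw [transfer_iterate_succ, transfer_iterate_succ, Finset.mul_sum]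
    exact Finset.sum_congr rfl fun j _ => by rw [ih]; ring

theorem transfer_iterate_sum {ι : Type*} (t : Finset ι) (g : ι → ℝ → ℝ) (n : ℕ) (x : ℝ) :
    (transfer ρ d p)^[n] (fun y => ∑ i ∈ t, g i y) x = ∑ i ∈ t, (transfer ρ d p)^[n] (g i) x := by
  induction n generalizing x with
  | zero => rfl
  | succ n ih =>
    simp only [transfer_iterate_succ, ih, Finset.mul_sum]
    exact Finset.sum_comm

theorem transfer_iterate_translate (hρ : ρ ≠ 0) (a : ℝ) (g : ℝ → ℝ) (n : ℕ) (x : ℝ) :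
    (transfer ρ d p)^[n] (fun y => g (y - a)) x = (transfer ρ d p)^[n] g (x - ρ ^ n * a) := by
  induction n generalizing x with
  | zero => simp
  | succ n ih =>
    rw [transfer_iterate_succ, transfer_iterate_succ]
    refine Finset.sum_congr rfl fun j _ => ?_
    have : (x - ρ ^ (n + 1) * a - d j) / ρ = (x - d j) / ρ - ρ ^ n * a := by
      field_simp
      ring
    rw [ih, this]

theorem transfer_iterate_reflect (hρ : ρ ≠ 0) (g : ℝ → ℝ) (n : ℕ) (x : ℝ) :
    (transfer ρ (fun j => 1 - ρ - d j) p)^[n] g (1 - x) =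
      (transfer ρ d p)^[n] (fun y => g (1 - y)) x := by
  induction n generalizing x with
  | zero => rfl
  | succ n ih =>
    rw [transfer_iterate_succ, transfer_iterate_succ]
    refine Finset.sum_congr rfl fun j _ => ?_
    have : (1 - x - (1 - ρ - d j)) / ρ = 1 - (x - d j) / ρ := by
      field_simp
      ring
    rw [← ih, this]

theorem coverWeight_nonneg (hp : ∀ j, 0 ≤ p j) (s : Set ℝ) (n : ℕ) (x : ℝ) :
    0 ≤ coverWeight ρ d p s n x := by
  induction n generalizing x with
  | zero => exact indicator_nonneg (fun _ _ => zero_le_one) x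
  | succ n ih =>
    rw [coverWeight_succ]
    exact Finset.sum_nonneg fun j _ => mul_nonneg (hp j) (ih _)

theorem coverWeight_eq_zero {s : Set ℝ} (hs : ∀ j x, (x - d j) / ρ ∈ s → x ∈ s) (n : ℕ) {x : ℝ}
    (hx : x ∉ s) : coverWeight ρ d p s n x = 0 := by
  induction n generalizing x with
  | zero => rw [coverWeight_zero, indicator_of_notMem hx]
  | succ n ih =>
    rw [coverWeight_succ]
    exact Finset.sum_eq_zero fun j _ => by rw [ih fun h => hx (hs j x h), mul_zero]

/-- At least one word of length `n` covers `x`, and each of its letters has probability at least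
`q`. -/
theorem pow_le_coverWeight {s : Set ℝ} (hs : ∀ x ∈ s, ∃ j, (x - d j) / ρ ∈ s) {q : ℝ}
    (hq : 0 ≤ q) (hqp : ∀ j, q ≤ p j) (n : ℕ) {x : ℝ} (hx : x ∈ s) :
    q ^ n ≤ coverWeight ρ d p s n x := by
  have hp : ∀ j, 0 ≤ p j := fun j => hq.trans (hqp j)
  induction n generalizing x with
  | zero => rw [coverWeight_zero, indicator_of_mem hx]; simp
  | succ n ih =>
    obtain ⟨j, hj⟩ := hs x hx
    rw [coverWeight_succ, pow_succ']
    calc q * q ^ n ≤ p j * coverWeight ρ d p s n ((x - d j) / ρ) :=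
          mul_le_mul (hqp j) (ih hj) (pow_nonneg hq n) (hp j)
      _ ≤ _ := Finset.single_le_sum
          (f := fun j => p j * coverWeight ρ d p s n ((x - d j) / ρ))
          (fun i _ => mul_nonneg (hp i) (coverWeight_nonneg hp _ _ _)) (Finset.mem_univ j)

theorem pow_mul_coverWeight_le {s : Set ℝ} (hs : ∀ x ∈ s, ∃ j, (x - d j) / ρ ∈ s) {q : ℝ}
    (hq : 0 ≤ q) (hqp : ∀ j, q ≤ p j) (n k : ℕ) (x : ℝ) :
    q ^ k * coverWeight ρ d p s n x ≤ coverWeight ρ d p s (n + k) x := by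
  have hp : ∀ j, 0 ≤ p j := fun j => hq.trans (hqp j)
  unfold coverWeight
  rw [← transfer_iterate_const_mul, Function.iterate_add_apply]
  refine transfer_iterate_mono hp (fun y => ?_) n x
  by_cases hy : y ∈ s
  · rw [indicator_of_mem hy, Pi.one_apply, mul_one]
    exact pow_le_coverWeight hs hq hqp k hy
  · rw [indicator_of_notMem hy, mul_zero]
    exact coverWeight_nonneg hp s k y

end Transfer

/-! ### Covers of the unit interval -/

/-- The maps `x ↦ ρ x + d_j` are distinct, send `[0,1]` into itself, and their images of
`[0,1)`, respectively of `(0,1]`, cover that interval. -/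
structure IsUnitCover {m : ℕ} (ρ : ℝ) (d : Fin (m + 1) → ℝ) : Prop where
  pos : 0 < ρ
  injective : Function.Injective d
  nonneg : ∀ j, 0 ≤ d j
  le : ∀ j, d j ≤ 1 - ρ
  cover_Ico : ∀ x ∈ Ico (0 : ℝ) 1, ∃ j, (x - d j) / ρ ∈ Ico (0 : ℝ) 1
  cover_Ioc : ∀ x ∈ Ioc (0 : ℝ) 1, ∃ j, (x - d j) / ρ ∈ Ioc (0 : ℝ) 1

namespace IsUnitCover

variable {m : ℕ} {ρ : ℝ} {d p : Fin (m + 1) → ℝ}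

/-- Points slightly to the right of `x` are covered; by pigeonhole one index `j` serves points
arbitrarily close to `x`. Its image contains `x` by closedness, and `x` is not the right end since
larger points belong to it. -/
theorem exists_Ico_of_closed {ρ : ℝ} (hρ : 0 < ρ) {d : Fin (m + 1) → ℝ}
    (h : ∀ x ∈ Icc (0 : ℝ) 1, ∃ j, (x - d j) / ρ ∈ Icc (0 : ℝ) 1) :
    ∀ x ∈ Ico (0 : ℝ) 1, ∃ j, (x - d j) / ρ ∈ Ico (0 : ℝ) 1 := by
  intro x hx
  have key : ∃ᶠ y in 𝓝[>] x, ∃ j, (y - d j) / ρ ∈ Icc (0 : ℝ) 1 ∧ x < y := by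
    refine Eventually.frequently ?_
    filter_upwards [Ioo_mem_nhdsGT hx.2] with y hy
    obtain ⟨j, hj⟩ := h y ⟨hx.1.trans hy.1.le, hy.2.le⟩
    exact ⟨j, hj, hy.1⟩
  obtain ⟨j, hj⟩ : ∃ j, ∃ᶠ y in 𝓝[>] x, (y - d j) / ρ ∈ Icc (0 : ℝ) 1 ∧ x < y := by
    by_contra hcon
    push Not at hcon
    have := eventually_all.2 fun j => hcon j
    exact key (this.mono fun y hy ⟨j, hj⟩ => not_le.2 hj.2 (hy j hj.1))
  refine ⟨j, ?_, ?_⟩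
  · have hc : Tendsto (fun y => (y - d j) / ρ) (𝓝[>] x) (𝓝 ((x - d j) / ρ)) :=
      (Continuous.tendsto (by fun_prop) x).mono_left nhdsWithin_le_nhds
    by_contra hneg
    exact hj ((hc.eventually (gt_mem_nhds (not_le.1 hneg))).mono
      fun y hy hy' => absurd hy'.1.1 (not_le.2 hy))
  · obtain ⟨y, hy, hxy⟩ := hj.exists
    exact lt_of_lt_of_le (div_lt_div_of_pos_right (by linarith) hρ) hy.2

theorem of_isSelfSimilarSet (hρ : 0 < ρ) (hd : Function.Injective d)
    (hK : IsSelfSimilarSet ρ d (Icc 0 1)) : IsUnitCover ρ d := by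
  obtain ⟨-, -, hK⟩ := hK
  have hmem : ∀ j, ∀ y ∈ Icc (0 : ℝ) 1, ρ * y + d j ∈ Icc (0 : ℝ) 1 := fun j y hy => by
    rw [hK]
    exact mem_iUnion.2 ⟨j, y, hy, rfl⟩
  have hcov : ∀ x ∈ Icc (0 : ℝ) 1, ∃ j, (x - d j) / ρ ∈ Icc (0 : ℝ) 1 := by
    intro x hx
    rw [hK] at hx
    obtain ⟨j, y, hy, rfl⟩ := mem_iUnion.1 hx
    refine ⟨j, ?_⟩
    rwa [simMap, add_sub_cancel_right, mul_div_cancel_left₀ _ hρ.ne']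
  refine ⟨hρ, hd, fun j => ?_, fun j => ?_, exists_Ico_of_closed hρ hcov, ?_⟩
  · simpa using (hmem j 0 (by simp)).1
  · have := (hmem j 1 (by simp)).2
    linarith
  · have hrefl : ∀ x j, (1 - x - (1 - ρ - d j)) / ρ = 1 - (x - d j) / ρ := fun x j => by
      field_simp
      ring
    intro x hx
    obtain ⟨j, hj⟩ := exists_Ico_of_closed (d := fun j => 1 - ρ - d j) hρ (fun y hy => by
      obtain ⟨j, hj⟩ := hcov (1 - y) ⟨by linarith [hy.2], by linarith [hy.1]⟩
      refine ⟨j, ?_⟩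
      have := hrefl (1 - y) j
      rw [sub_sub_cancel] at this
      rw [this]
      exact ⟨by linarith [hj.2], by linarith [hj.1]⟩) (1 - x) ⟨by linarith [hx.2], by linarith [hx.1]⟩
    rw [hrefl] at hj
    exact ⟨j, by linarith [hj.2], by linarith [hj.1]⟩

theorem reflect (H : IsUnitCover ρ d) : IsUnitCover ρ fun j => 1 - ρ - d j := by
  have hρ := H.pos
  have hrefl : ∀ x j, (x - (1 - ρ - d j)) / ρ = 1 - (1 - x - d j) / ρ := fun x j => by
    field_simp
    ring
  refine ⟨hρ, fun i j hij => H.injective (by simpa using hij), fun j => by linarith [H.le j],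
    fun j => by linarith [H.nonneg j], fun x hx => ?_, fun x hx => ?_⟩
  · obtain ⟨j, hj⟩ := H.cover_Ioc (1 - x) ⟨by linarith [hx.2], by linarith [hx.1]⟩
    exact ⟨j, by rw [hrefl]; exact ⟨by linarith [hj.2], by linarith [hj.1]⟩⟩
  · obtain ⟨j, hj⟩ := H.cover_Ico (1 - x) ⟨by linarith [hx.2], by linarith [hx.1]⟩
    exact ⟨j, by rw [hrefl]; exact ⟨by linarith [hj.2], by linarith [hj.1]⟩⟩

theorem mem_Ico (H : IsUnitCover ρ d) (j : Fin (m + 1)) (x : ℝ)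
    (hx : (x - d j) / ρ ∈ Ico (0 : ℝ) 1) : x ∈ Ico (0 : ℝ) 1 := by
  have h1 := (le_div_iff₀ H.pos).1 hx.1
  have h2 := (div_lt_iff₀ H.pos).1 hx.2
  exact ⟨by linarith [H.nonneg j], by linarith [H.le j]⟩

theorem mem_Ioc (H : IsUnitCover ρ d) (j : Fin (m + 1)) (x : ℝ)
    (hx : (x - d j) / ρ ∈ Ioc (0 : ℝ) 1) : x ∈ Ioc (0 : ℝ) 1 := by
  have h1 := (lt_div_iff₀ H.pos).1 hx.1
  have h2 := (div_le_iff₀ H.pos).1 hx.2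
  exact ⟨by linarith [H.nonneg j], by linarith [H.le j]⟩

theorem exists_eq_right (H : IsUnitCover ρ d) : ∃ j, d j = 1 - ρ := by
  obtain ⟨j, hj⟩ := H.cover_Ioc 1 (by simp)
  have := (div_le_iff₀ H.pos).1 hj.2
  exact ⟨j, le_antisymm (H.le j) (by linarith)⟩

/-- Only the right-most letter, repeated `n` times, reaches the point 1. -/
theorem coverWeight_Ioc_one_le (H : IsUnitCover ρ d) {q : ℝ} (hq : 0 ≤ q)
    (hqr : ∀ j, d j = 1 - ρ → p j = q) (n : ℕ) :
    coverWeight ρ d p (Ioc 0 1) n 1 ≤ q ^ n := by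
  induction n with
  | zero => rw [coverWeight_zero, indicator_of_mem (by simp)]; simp
  | succ n ih =>
    obtain ⟨b, hb⟩ := H.exists_eq_right
    rw [coverWeight_succ, Finset.sum_eq_single b, hb, hqr b hb, pow_succ']
    · have : (1 - (1 - ρ)) / ρ = 1 := by rw [sub_sub_cancel, div_self H.pos.ne']
      rw [this]
      exact mul_le_mul_of_nonneg_left ih hq
    · intro j _ hjb
      have hlt : d j < 1 - ρ :=
        lt_of_le_of_ne (H.le j) fun h => hjb (H.injective (h.trans hb.symm))
      rw [coverWeight_eq_zero H.mem_Ioc, mul_zero]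
      exact fun h => absurd ((div_le_iff₀ H.pos).1 h.2) (by linarith)
    · exact fun h => absurd (Finset.mem_univ b) h

/-- Split off the first letter. Preimages inside (0,1) fall under the induction hypothesis; a
preimage equal to 1 has `Ico` weight zero but `Ioc` weight at most `q ^ n`. This additive error is
paid for by the weight of `x` itself, so the constant grows by `1 / q` per level. -/
theorem coverWeight_Ioc_le (H : IsUnitCover ρ d) (hp1 : ∑ j, p j = 1) {q : ℝ} (hq : 0 < q)
    (hqp : ∀ j, q ≤ p j) (hqr : ∀ j, d j = 1 - ρ → p j = q) (n : ℕ) {x : ℝ}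
    (hx : x ∈ Ioo (0 : ℝ) 1) :
    coverWeight ρ d p (Ioc 0 1) n x ≤ (1 + n / q) * coverWeight ρ d p (Ico 0 1) n x := by
  have hp : ∀ j, 0 ≤ p j := fun j => hq.le.trans (hqp j)
  induction n generalizing x with
  | zero =>
    rw [coverWeight_zero, coverWeight_zero, indicator_of_mem (Ioo_subset_Ioc_self hx),
      indicator_of_mem (Ioo_subset_Ico_self hx)]
    simp
  | succ n ih =>
    have hD : 0 ≤ 1 + n / q := by positivity
    have step : ∀ y, coverWeight ρ d p (Ioc 0 1) n y ≤
        (1 + n / q) * coverWeight ρ d p (Ico 0 1) n y + q ^ n := by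
      intro y
      have h0 := mul_nonneg hD (coverWeight_nonneg (ρ := ρ) (d := d) hp (Ico 0 1) n y)
      have hqn := pow_nonneg hq.le n
      by_cases hy : y ∈ Ioc (0 : ℝ) 1
      · rcases hy.2.lt_or_eq with h | rfl
        · linarith [ih ⟨hy.1, h⟩]
        · linarith [H.coverWeight_Ioc_one_le (p := p) hq.le hqr n]
      · rw [coverWeight_eq_zero H.mem_Ioc n hy]
        linarith
    -- Covering puts at least `q ^ (n + 1)` on `x`; this is where minimality of the extreme
    -- probability enters.
    have hlow : q ^ n ≤ 1 / q * coverWeight ρ d p (Ico 0 1) (n + 1) x := by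
      have := pow_le_coverWeight H.cover_Ico hq.le hqp (n + 1) (x := x) (Ioo_subset_Ico_self hx)
      rw [one_div_mul_eq_div, le_div_iff₀ hq]
      rwa [pow_succ] at this
    calc coverWeight ρ d p (Ioc 0 1) (n + 1) x
        ≤ ∑ j, p j * ((1 + n / q) * coverWeight ρ d p (Ico 0 1) n ((x - d j) / ρ) + q ^ n) := by
          rw [coverWeight_succ]
          exact Finset.sum_le_sum fun j _ => mul_le_mul_of_nonneg_left (step _) (hp j)
      _ = (1 + n / q) * coverWeight ρ d p (Ico 0 1) (n + 1) x + q ^ n := by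
          rw [coverWeight_succ, Finset.mul_sum]
          simp only [mul_add, Finset.sum_add_distrib]
          rw [← Finset.sum_mul, hp1, one_mul]
          congr 1
          exact Finset.sum_congr rfl fun j _ => by ring
      _ ≤ _ := by
          push_cast
          rw [add_div, ← add_assoc, add_mul _ (1 / q)]
          linarith

theorem coverWeight_reflect (hρ : ρ ≠ 0) (n : ℕ) (x : ℝ) :
    coverWeight ρ (fun j => 1 - ρ - d j) p (Ioc 0 1) n (1 - x) =
        coverWeight ρ d p (Ico 0 1) n x ∧
      coverWeight ρ (fun j => 1 - ρ - d j) p (Ico 0 1) n (1 - x) =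
        coverWeight ρ d p (Ioc 0 1) n x := by
  unfold coverWeight
  rw [transfer_iterate_reflect hρ, transfer_iterate_reflect hρ]
  have h1 : ∀ y : ℝ, 1 - y ∈ Ioc (0 : ℝ) 1 ↔ y ∈ Ico (0 : ℝ) 1 := fun y =>
    ⟨fun h => ⟨by linarith [h.2], by linarith [h.1]⟩,
      fun h => ⟨by linarith [h.2], by linarith [h.1]⟩⟩
  have h2 : ∀ y : ℝ, 1 - y ∈ Ico (0 : ℝ) 1 ↔ y ∈ Ioc (0 : ℝ) 1 := fun y =>
    ⟨fun h => ⟨by linarith [h.2], by linarith [h.1]⟩,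
      fun h => ⟨by linarith [h.2], by linarith [h.1]⟩⟩
  constructor <;>
  · refine congrArg (fun g => (transfer ρ d p)^[n] g x) (funext fun y => ?_)
    simp only [indicator_apply, h1, h2, Pi.one_apply]

theorem coverWeight_Ico_le (H : IsUnitCover ρ d) (hp1 : ∑ j, p j = 1) {q : ℝ} (hq : 0 < q)
    (hqp : ∀ j, q ≤ p j) (hql : ∀ j, d j = 0 → p j = q) (n : ℕ) {x : ℝ}
    (hx : x ∈ Ioo (0 : ℝ) 1) :
    coverWeight ρ d p (Ico 0 1) n x ≤ (1 + n / q) * coverWeight ρ d p (Ioc 0 1) n x := by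
  have := H.reflect.coverWeight_Ioc_le hp1 hq hqp (fun j hj => hql j (by linarith)) n
    (x := 1 - x) ⟨by linarith [hx.2], by linarith [hx.1]⟩
  rwa [(coverWeight_reflect H.pos.ne' n x).1, (coverWeight_reflect H.pos.ne' n x).2] at this

end IsUnitCover

/-! ### Step functions with comparable one-sided limits -/

/-- Here `E` contains the jumps of the right-continuous step function `f`, and `g e` is the left
limit of `f` at `e`. Each jump between `x` and `y` costs a factor `D`; the induction removes the
last one. -/
theorem step_comparable {f g : ℝ → ℝ} {E : Finset ℝ} {D : ℝ} (hD : 1 ≤ D) (hf : ∀ x, 0 ≤ f x)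
    (hright : ∀ x y, x ≤ y → (∀ e ∈ E, x < e → y < e) → f x = f y)
    (hleft : ∀ x y, x < y → (∀ e ∈ E, x < e → y ≤ e) → f x = g y)
    (hfg : ∀ e ∈ Ioo (0 : ℝ) 1, f e ≤ D * g e) (hgf : ∀ e ∈ Ioo (0 : ℝ) 1, g e ≤ D * f e)
    (k : ℕ) {x y : ℝ} (hx : 0 ≤ x) (hxy : x ≤ y) (hy : y < 1)
    (hk : (E.filter fun e => e ∈ Ioc x y).card ≤ k) :
    f x ≤ D ^ k * f y ∧ f y ≤ D ^ k * f x := by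
  induction k generalizing x y with
  | zero =>
    have hE : f x = f y := hright x y hxy fun e he hxe => by
      by_contra hle
      have : e ∈ E.filter fun e => e ∈ Ioc x y := Finset.mem_filter.2 ⟨he, hxe, not_lt.1 hle⟩
      rw [Finset.card_eq_zero.1 (Nat.le_zero.1 hk)] at this
      exact Finset.notMem_empty e this
    simp [hE]
  | succ k ih =>
    rcases (E.filter fun e => e ∈ Ioc x y).eq_empty_or_nonempty with hemp | hne
    · obtain ⟨h1, h2⟩ := ih hx hxy hy (by rw [hemp]; simp)
      have hpow : D ^ k ≤ D ^ (k + 1) := pow_le_pow_right₀ hD (Nat.le_succ k)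
      exact ⟨h1.trans (mul_le_mul_of_nonneg_right hpow (hf y)),
        h2.trans (mul_le_mul_of_nonneg_right hpow (hf x))⟩
    · set e := (E.filter fun e => e ∈ Ioc x y).max' hne with he
      obtain ⟨heE, hxe, hey⟩ := Finset.mem_filter.1 (Finset.max'_mem _ hne)
      rw [← he] at heE hxe hey
      have hfe : f e = f y := hright e y hey fun e' he' hlt => by
        by_contra hle
        exact absurd (Finset.le_max' (E.filter fun e => e ∈ Ioc x y) e'
          (Finset.mem_filter.2 ⟨he', hxe.trans hlt, not_lt.1 hle⟩)) (not_le.2 hlt)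
      have hne' : (insert x (E.filter fun e' => e' ∈ Ioo x e)).Nonempty :=
        Finset.insert_nonempty _ _
      -- The point `z` is the last jump in (x, e), or `x` if there is none, so `f z` is the left
      -- limit at `e`.
      obtain ⟨z, hz⟩ : ∃ z, z = (insert x (E.filter fun e' => e' ∈ Ioo x e)).max' hne' := ⟨_, rfl⟩
      have hzle : ∀ e' ∈ E, x < e' → e' < e → e' ≤ z := fun e' he' h1 h2 => by
        rw [hz]
        exact Finset.le_max' _ _ (Finset.mem_insert_of_mem (Finset.mem_filter.2 ⟨he', h1, h2⟩))
      have hxz : x ≤ z := by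
        rw [hz]
        exact Finset.le_max' _ _ (Finset.mem_insert_self _ _)
      have hze : z < e := by
        rw [hz, Finset.max'_lt_iff]
        intro u hu
        rcases Finset.mem_insert.1 hu with rfl | hu
        · exact hxe
        · exact (Finset.mem_filter.1 hu).2.2
      have hfz : f z = g e := hleft z e hze fun e' he' h1 => by
        by_contra hlt
        exact absurd (hzle e' he' (hxz.trans_lt h1) (not_le.1 hlt)) (not_le.2 h1)
      have hcard : (E.filter fun e => e ∈ Ioc x z).card ≤ k := by
        refine Nat.le_of_lt_succ (lt_of_lt_of_le (Finset.card_lt_card ?_) hk)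
        refine Finset.ssubset_iff_subset_ne.2 ⟨fun u hu => ?_, fun heq => ?_⟩
        · obtain ⟨h1, h2, h3⟩ := Finset.mem_filter.1 hu
          exact Finset.mem_filter.2 ⟨h1, h2, h3.trans (hze.le.trans hey)⟩
        · have : e ∈ E.filter fun e => e ∈ Ioc x y := Finset.mem_filter.2 ⟨heE, hxe, hey⟩
          rw [← heq] at this
          exact absurd (Finset.mem_filter.1 this).2.2 (not_le.2 hze)
      obtain ⟨h1, h2⟩ := ih hx hxz (hze.trans (hey.trans_lt hy)) hcard
      have heI : e ∈ Ioo (0 : ℝ) 1 := ⟨hx.trans_lt hxe, hey.trans_lt hy⟩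
      have hDk : 0 ≤ D ^ k := by positivity
      rw [hfz] at h1 h2
      constructor
      · calc f x ≤ D ^ k * g e := h1
          _ ≤ D ^ k * (D * f e) := mul_le_mul_of_nonneg_left (hgf e heI) hDk
          _ = D ^ (k + 1) * f y := by rw [hfe]; ring
      · calc f y = f e := hfe.symm
          _ ≤ D * g e := hfg e heI
          _ ≤ D * (D ^ k * f x) := mul_le_mul_of_nonneg_left h2 (by linarith)
          _ = D ^ (k + 1) * f x := by ring

/-! ### End points of the images of the unit interval -/

/-- The end points of the intervals `S_w [0,1]` with `w` of length `n`. -/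
noncomputable def coverEndpoints {m : ℕ} (ρ : ℝ) (d : Fin (m + 1) → ℝ) : ℕ → Finset ℝ
  | 0 => {0, 1}
  | n + 1 => Finset.univ.biUnion fun j => (coverEndpoints ρ d n).image (simMap ρ d j)

section Endpoints

variable {m : ℕ} {ρ : ℝ} {d p : Fin (m + 1) → ℝ}

theorem simMap_mem_coverEndpoints {n : ℕ} {e : ℝ} (he : e ∈ coverEndpoints ρ d n)
    (j : Fin (m + 1)) : simMap ρ d j e ∈ coverEndpoints ρ d (n + 1) :=
  Finset.mem_biUnion.2 ⟨j, Finset.mem_univ j, Finset.mem_image_of_mem _ he⟩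

theorem exists_word_of_mem_coverEndpoints {n : ℕ} {e : ℝ} (he : e ∈ coverEndpoints ρ d n) :
    ∃ w : List (Fin (m + 1)), w.length = n ∧
      (e = wordMap ρ d w 0 ∨ e = wordMap ρ d w 0 + ρ ^ n) := by
  induction n generalizing e with
  | zero =>
    refine ⟨[], rfl, ?_⟩
    simpa [coverEndpoints, wordMap] using he
  | succ n ih =>
    obtain ⟨j, -, he⟩ := Finset.mem_biUnion.1 he
    obtain ⟨e', he', rfl⟩ := Finset.mem_image.1 he
    obtain ⟨w, hw, h⟩ := ih he'
    refine ⟨j :: w, by simp [hw], ?_⟩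
    rcases h with rfl | rfl
    · exact Or.inl rfl
    · refine Or.inr ?_
      simp only [wordMap, simMap]
      ring

theorem lt_simMap_iff (hρ : 0 < ρ) (j : Fin (m + 1)) (x e : ℝ) :
    x < simMap ρ d j e ↔ (x - d j) / ρ < e := by
  rw [div_lt_iff₀ hρ, simMap, sub_lt_iff_lt_add, mul_comm]

theorem le_simMap_iff (hρ : 0 < ρ) (j : Fin (m + 1)) (x e : ℝ) :
    x ≤ simMap ρ d j e ↔ (x - d j) / ρ ≤ e := by
  rw [div_le_iff₀ hρ, simMap, sub_le_iff_le_add, mul_comm]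

theorem coverWeight_Ico_eq_of_forall (hρ : 0 < ρ) (n : ℕ) {x y : ℝ} (hxy : x ≤ y)
    (h : ∀ e ∈ coverEndpoints ρ d n, x < e → y < e) :
    coverWeight ρ d p (Ico 0 1) n x = coverWeight ρ d p (Ico 0 1) n y := by
  induction n generalizing x y with
  | zero =>
    have h0 := h 0 (by simp [coverEndpoints])
    have h1 := h 1 (by simp [coverEndpoints])
    have : x ∈ Ico (0 : ℝ) 1 ↔ y ∈ Ico (0 : ℝ) 1 :=
      ⟨fun hx => ⟨hx.1.trans hxy, h1 hx.2⟩,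
        fun hy => ⟨not_lt.1 fun hx => absurd (h0 hx) (not_lt.2 hy.1), hxy.trans_lt hy.2⟩⟩
    simp only [coverWeight_zero, indicator_apply, this, Pi.one_apply]
  | succ n ih =>
    rw [coverWeight_succ, coverWeight_succ]
    refine Finset.sum_congr rfl fun j _ => ?_
    rw [ih (div_le_div_of_nonneg_right (by linarith) hρ.le) fun e he hlt =>
      (lt_simMap_iff hρ j y e).1 (h _ (simMap_mem_coverEndpoints he j)
        ((lt_simMap_iff hρ j x e).2 hlt))]

/-- Identifies the `Ioc` weight as the left limit of the `Ico` weight: this holds for the indicators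
and is preserved by increasing affine substitutions. -/
theorem coverWeight_Ico_eq_Ioc_of_forall (hρ : 0 < ρ) (n : ℕ) {x y : ℝ} (hxy : x < y)
    (h : ∀ e ∈ coverEndpoints ρ d n, x < e → y ≤ e) :
    coverWeight ρ d p (Ico 0 1) n x = coverWeight ρ d p (Ioc 0 1) n y := by
  induction n generalizing x y with
  | zero =>
    have h0 := h 0 (by simp [coverEndpoints])
    have h1 := h 1 (by simp [coverEndpoints])
    have : x ∈ Ico (0 : ℝ) 1 ↔ y ∈ Ioc (0 : ℝ) 1 :=
      ⟨fun hx => ⟨hx.1.trans_lt hxy, h1 hx.2⟩,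
        fun hy => ⟨not_lt.1 fun hx => absurd (h0 hx) (not_le.2 hy.1), hxy.trans_le hy.2⟩⟩
    simp only [coverWeight_zero, indicator_apply, this, Pi.one_apply]
  | succ n ih =>
    rw [coverWeight_succ, coverWeight_succ]
    refine Finset.sum_congr rfl fun j _ => ?_
    rw [ih (div_lt_div_of_pos_right (by linarith) hρ) fun e he hlt =>
      (le_simMap_iff hρ j y e).1 (h _ (simMap_mem_coverEndpoints he j)
        ((lt_simMap_iff hρ j x e).2 hlt))]

/-- Distance to the minimum of `A` determines a point of `A`. -/
theorem card_le_of_forall_abs_sub_mem {A F : Finset ℝ} {c : ℝ} (hc : c ≠ 0)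
    (h : ∀ z ∈ A, ∀ w ∈ A, c * |z - w| ∈ F) : A.card ≤ F.card := by
  rcases A.eq_empty_or_nonempty with rfl | hA
  · simp
  · refine Finset.card_le_card_of_injOn (fun z => c * |z - A.min' hA|)
      (fun z hz => h z hz _ (A.min'_mem hA)) fun z hz w hw hzw => ?_
    have h1 := A.min'_le z hz
    have h2 := A.min'_le w hw
    have := mul_left_cancel₀ hc hzw
    rw [abs_of_nonneg (by linarith), abs_of_nonneg (by linarith)] at this
    linarith

/-- Finite type bounds the number of end points of level `n` in an interval of length `ρ ^ n`. -/
theorem exists_card_coverEndpoints_le (hρ : 0 < ρ) (hft : IsFiniteType ρ d (Icc 0 1)) :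
    ∃ k : ℕ, ∀ (n : ℕ) (x y : ℝ), y - x ≤ ρ ^ n →
      ((coverEndpoints ρ d n).filter fun e => e ∈ Ioc x y).card ≤ k := by
  obtain ⟨F, hF, h⟩ := hft
  have hdiam : Metric.diam (Icc (0 : ℝ) 1) = 1 := by
    rw [Real.diam_Icc zero_le_one, sub_zero]
  rw [hdiam] at h
  -- Left and right end points are counted separately: two of the same kind differ by S_v(0) -
  -- S_w(0).
  refine ⟨hF.toFinset.card + hF.toFinset.card, fun n x y hxy => ?_⟩
  classical
  set B := (coverEndpoints ρ d n).filter fun e => e ∈ Ioc x y with hB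
  have hclose : ∀ z ∈ B, ∀ w ∈ B, |z - w| ≤ ρ ^ n := fun z hz w hw => by
    have h1 := (Finset.mem_filter.1 hz).2
    have h2 := (Finset.mem_filter.1 hw).2
    exact abs_le.2 ⟨by linarith [h1.1, h2.2], by linarith [h1.2, h2.1]⟩
  have hcount : ∀ t : ℝ, ((B.filter fun e => ∃ w : List (Fin (m + 1)), w.length = n ∧
      e = wordMap ρ d w 0 + t)).card ≤ hF.toFinset.card := fun t => by
    refine card_le_of_forall_abs_sub_mem (inv_ne_zero (pow_pos hρ n).ne') fun z hz w hw => ?_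
    obtain ⟨hzB, v, hv, rfl⟩ := Finset.mem_filter.1 hz
    obtain ⟨hwB, v', hv', rfl⟩ := Finset.mem_filter.1 hw
    have hle := hclose _ hzB _ hwB
    rw [add_sub_add_right_eq_sub] at hle ⊢
    rw [Set.Finite.mem_toFinset]
    exact (h n v v' hv hv').resolve_left (by rw [one_mul]; exact not_lt.2 hle)
  refine (Finset.card_le_card fun e he => ?_).trans ((Finset.card_union_le _ _).trans
    (add_le_add (hcount 0) (hcount (ρ ^ n))))
  obtain ⟨w, hw, hew⟩ := exists_word_of_mem_coverEndpoints (Finset.mem_filter.1 he).1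
  refine Finset.mem_union.2 (hew.imp (fun h => ?_) fun h => ?_)
  · exact Finset.mem_filter.2 ⟨he, w, hw, by rw [add_zero]; exact h⟩
  · exact Finset.mem_filter.2 ⟨he, w, hw, h⟩

/-- Regularity and finite type make the weights at points of distance at most `ρ ^ n` comparable
up to a factor that is polynomial in `n`. -/
theorem IsUnitCover.exists_coverWeight_le (H : IsUnitCover ρ d)
    (hft : IsFiniteType ρ d (Icc 0 1)) (hp1 : ∑ j, p j = 1) {q : ℝ} (hq : 0 < q)
    (hqp : ∀ j, q ≤ p j) (hql : ∀ j, d j = 0 → p j = q) (hqr : ∀ j, d j = 1 - ρ → p j = q) :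
    ∃ k : ℕ, ∀ (n : ℕ), ∀ x ∈ Ico (0 : ℝ) 1, ∀ y ∈ Ico (0 : ℝ) 1, |x - y| ≤ ρ ^ n →
      coverWeight ρ d p (Ico 0 1) n x ≤ (1 + n / q) ^ k * coverWeight ρ d p (Ico 0 1) n y := by
  obtain ⟨k, hk⟩ := exists_card_coverEndpoints_le H.pos hft
  refine ⟨k, fun n => ?_⟩
  have key : ∀ x y : ℝ, 0 ≤ x → x ≤ y → y < 1 → y - x ≤ ρ ^ n → _ := fun x y h0 h1 h2 h3 =>
    step_comparable (f := coverWeight ρ d p (Ico 0 1) n) (D := 1 + n / q)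
      (le_add_of_nonneg_right (by positivity))
      (coverWeight_nonneg (fun j => hq.le.trans (hqp j)) _ n)
      (fun _ _ => coverWeight_Ico_eq_of_forall H.pos n)
      (fun _ _ => coverWeight_Ico_eq_Ioc_of_forall H.pos n)
      (fun _ he => H.coverWeight_Ico_le hp1 hq hqp hql n he)
      (fun _ he => H.coverWeight_Ioc_le hp1 hq hqp hqr n he) k h0 h1 h2 (hk n x y h3)
  intro x hx y hy hxy
  rcases le_total x y with h | h
  · exact (key x y hx.1 h hy.2 (by rw [abs_le] at hxy; linarith)).1
  · exact (key y x hy.1 h hx.2 (by rw [abs_le] at hxy; linarith)).2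

end Endpoints

/-! ### Self-similar measures -/

section SelfSimilar

variable {m : ℕ} {ρ : ℝ} {d p : Fin (m + 1) → ℝ} {μ : Measure ℝ} [IsProbabilityMeasure μ]

theorem IsSelfSimilarMeasure.real_eq (hμ : IsSelfSimilarMeasure ρ d p μ) (hp : ∀ j, 0 ≤ p j)
    {E : Set ℝ} (hE : MeasurableSet E) :
    μ.real E = ∑ j, p j * μ.real (simMap ρ d j ⁻¹' E) := by
  rw [measureReal_def, hμ E hE, ENNReal.toReal_sum fun j _ =>
    ENNReal.mul_ne_top ENNReal.ofReal_ne_top (measure_ne_top _ _)]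
  exact Finset.sum_congr rfl fun j _ => by
    rw [ENNReal.toReal_mul, ENNReal.toReal_ofReal (hp j), measureReal_def]

/-- Pulling a closed ball back by S_j divides its radius by `ρ`, so `n` steps reach radius 1. -/
theorem IsSelfSimilarMeasure.real_closedBall (hμ : IsSelfSimilarMeasure ρ d p μ)
    (hp : ∀ j, 0 ≤ p j) (hρ : 0 < ρ) (n : ℕ) (x : ℝ) :
    μ.real (Metric.closedBall x (ρ ^ n)) =
      (transfer ρ d p)^[n] (fun y => μ.real (Metric.closedBall y 1)) x := by
  induction n generalizing x with
  | zero => simp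
  | succ n ih =>
    rw [hμ.real_eq hp Metric.isClosed_closedBall.measurableSet, transfer_iterate_succ]
    refine Finset.sum_congr rfl fun j _ => ?_
    rw [← ih]
    congr 2
    ext y
    have : simMap ρ d j y - x = ρ * (y - (x - d j) / ρ) := by
      rw [simMap]
      field_simp
      ring
    rw [mem_preimage, Metric.mem_closedBall, Metric.mem_closedBall, Real.dist_eq, Real.dist_eq,
      this, abs_mul, abs_of_pos hρ, pow_succ', mul_le_mul_iff_right₀ hρ]

/-- Every S_j maps the (t/ρ)-neighbourhood of [0,1] into the t-neighbourhood, so the latter has at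
least the mass of the former. Iterating, the neighbourhoods exhaust the line, and each one has full
mass. -/
theorem IsSelfSimilarMeasure.ae_mem_Icc (hμ : IsSelfSimilarMeasure ρ d p μ) (hp : ∀ j, 0 ≤ p j)
    (hp1 : ∑ j, p j = 1) (H : IsUnitCover ρ d) (hρ1 : ρ < 1) : ∀ᵐ x ∂μ, x ∈ Icc (0 : ℝ) 1 := by
  have hρ := H.pos
  have hstep : ∀ t : ℝ, μ.real (Icc (-(t / ρ)) (1 + t / ρ)) ≤ μ.real (Icc (-t) (1 + t)) := by
    intro t
    rw [hμ.real_eq hp measurableSet_Icc (E := Icc (-t) (1 + t))]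
    rw [← one_mul (μ.real (Icc (-(t / ρ)) _))]
    nth_rewrite 1 [← hp1]
    rw [Finset.sum_mul]
    refine Finset.sum_le_sum fun j _ => mul_le_mul_of_nonneg_left ?_ (hp j)
    refine measureReal_mono fun y hy => ?_
    have h1 : -t ≤ ρ * y := by
      have := mul_le_mul_of_nonneg_left hy.1 hρ.le
      rwa [mul_neg, mul_div_cancel₀ _ hρ.ne'] at this
    have h2 : ρ * y ≤ ρ + t := by
      have := mul_le_mul_of_nonneg_left hy.2 hρ.le
      rwa [mul_add, mul_one, mul_div_cancel₀ _ hρ.ne'] at this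
    exact ⟨by rw [simMap]; linarith [H.nonneg j], by rw [simMap]; linarith [H.le j]⟩
  have hiter : ∀ (n : ℕ) (t : ℝ),
      μ.real (Icc (-(t / ρ ^ n)) (1 + t / ρ ^ n)) ≤ μ.real (Icc (-t) (1 + t)) := by
    intro n
    induction n with
    | zero => intro t; simp
    | succ n ih =>
      intro t
      have h := (hstep (t / ρ ^ n)).trans (ih t)
      rwa [div_div, ← pow_succ] at h
  have hfull : ∀ t : ℝ, 0 < t → ∀ᵐ x ∂μ, x ∈ Icc (-t) (1 + t) := by
    intro t ht
    have hmono : Monotone fun s : ℝ => Icc (-s) (1 + s) := fun a b hab =>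
      Icc_subset_Icc (by linarith) (by linarith)
    have hU : ⋃ s : ℝ, Icc (-s) (1 + s) = univ := by
      refine eq_univ_of_forall fun x => mem_iUnion.2 ⟨|x|, neg_abs_le x, ?_⟩
      linarith [le_abs_self x]
    have hlim : Tendsto (fun n : ℕ => t / ρ ^ n) atTop atTop := by
      have := (tendsto_pow_atTop_atTop_of_one_lt (one_lt_inv₀ hρ |>.2 hρ1)).const_mul_atTop ht
      simpa [div_eq_mul_inv] using this
    have h1 := (tendsto_measure_iUnion_atTop (μ := μ) hmono).comp hlim
    rw [hU, measure_univ] at h1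
    have h2 : (1 : ENNReal) ≤ μ (Icc (-t) (1 + t)) := le_of_tendsto' h1 fun n =>
      (ENNReal.toReal_le_toReal (measure_ne_top _ _) (measure_ne_top _ _)).1 (hiter n t)
    exact (prob_compl_eq_zero_iff measurableSet_Icc).2 (le_antisymm prob_le_one h2)
  have hall := ae_all_iff.2 fun n : ℕ => hfull (1 / ((n : ℝ) + 1)) (by positivity)
  filter_upwards [hall] with x hx
  constructor
  · refine le_of_forall_pos_le_add fun ε hε => ?_
    obtain ⟨n, hn⟩ := exists_nat_one_div_lt hε
    linarith [(hx n).1]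
  · refine le_of_forall_pos_le_add fun ε hε => ?_
    obtain ⟨n, hn⟩ := exists_nat_one_div_lt hε
    linarith [(hx n).2]

/-- The ball misses [0,1] unless -1 ≤ y ≤ 2, and such a `y` lies in one of four unit intervals. -/
theorem real_closedBall_one_le (hae : ∀ᵐ x ∂μ, x ∈ Icc (0 : ℝ) 1) (y : ℝ) :
    μ.real (Metric.closedBall y 1) ≤
      ∑ i ∈ Finset.range 4, (Ico (0 : ℝ) 1).indicator 1 (y - ((i : ℝ) - 1)) := by
  have hnn : ∀ i ∈ Finset.range 4,
      (0 : ℝ) ≤ (Ico (0 : ℝ) 1).indicator 1 (y - ((i : ℝ) - 1)) :=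
    fun i _ => indicator_nonneg (fun _ _ => zero_le_one) _
  by_cases hy : y ∈ Icc (-1 : ℝ) 2
  · have h1 : -1 ≤ ⌊y⌋ := Int.le_floor.2 (by simpa using hy.1)
    have h2 : ⌊y⌋ ≤ 2 := Int.floor_le_iff.2 (by push_cast; linarith [hy.2])
    obtain ⟨i, hi⟩ := Int.eq_ofNat_of_zero_le (show 0 ≤ ⌊y⌋ + 1 by omega)
    have hi' : (i : ℝ) - 1 = (⌊y⌋ : ℝ) := by
      have : ((⌊y⌋ + 1 : ℤ) : ℝ) = ((i : ℤ) : ℝ) := by rw [hi]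
      push_cast at this
      linarith
    refine le_trans ?_ (Finset.single_le_sum hnn (Finset.mem_range.2 (show i < 4 by omega)))
    have hmem : y - (⌊y⌋ : ℝ) ∈ Ico (0 : ℝ) 1 :=
      ⟨by linarith [Int.floor_le y], by linarith [Int.lt_floor_add_one y]⟩
    rw [hi', indicator_of_mem hmem]
    exact measureReal_le_one
  · refine le_trans (le_of_eq ?_) (Finset.sum_nonneg hnn)
    rw [measureReal_def, measure_mono_null (fun z hz => ?_) hae, ENNReal.toReal_zero]
    intro hz'
    rw [Metric.mem_closedBall, Real.dist_eq, abs_le] at hz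
    exact hy ⟨by linarith [hz.2, hz'.1], by linarith [hz.1, hz'.2]⟩

theorem indicator_le_real_closedBall_one (hae : ∀ᵐ x ∂μ, x ∈ Icc (0 : ℝ) 1) (y : ℝ) :
    (Ico (0 : ℝ) 1).indicator 1 y ≤ μ.real (Metric.closedBall y 1) := by
  refine indicator_le' (g := fun y => μ.real (Metric.closedBall y 1)) (fun y hy => ?_)
    (fun _ _ => measureReal_nonneg) y
  have : μ (Metric.closedBall y 1) = 1 := by
    refine le_antisymm prob_le_one ?_
    rw [← (prob_compl_eq_zero_iff measurableSet_Icc).1 hae]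
    refine measure_mono fun z hz => ?_
    rw [Metric.mem_closedBall, Real.dist_eq, abs_le]
    exact ⟨by linarith [hz.1, hy.2], by linarith [hz.2, hy.1]⟩
  simp [measureReal_def, this]

/-- Doubling up to polynomial factors, along the scales `ρ ^ n`. -/
theorem IsSelfSimilarMeasure.exists_real_closedBall_le (hμ : IsSelfSimilarMeasure ρ d p μ)
    (H : IsUnitCover ρ d) (hρ1 : ρ < 1) (hft : IsFiniteType ρ d (Icc 0 1))
    (hp1 : ∑ j, p j = 1) {q : ℝ} (hq : 0 < q) (hqp : ∀ j, q ≤ p j)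
    (hql : ∀ j, d j = 0 → p j = q) (hqr : ∀ j, d j = 1 - ρ → p j = q) :
    ∃ K : ℕ, ∀ x ∈ Ico (0 : ℝ) 1, ∀ n k : ℕ,
      q ^ k * μ.real (Metric.closedBall x (ρ ^ n)) ≤
        4 * (1 + n / q) ^ K * μ.real (Metric.closedBall x (ρ ^ (n + k))) := by
  have hp : ∀ j, 0 ≤ p j := fun j => hq.le.trans (hqp j)
  have hρ := H.pos
  have hae := hμ.ae_mem_Icc hp hp1 H hρ1
  obtain ⟨K, hK⟩ := H.exists_coverWeight_le hft hp1 hq hqp hql hqr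
  -- The translates lie up to `2 * ρ ^ n` away, so the comparison is used twice, through the
  -- midpoint.
  refine ⟨K + K, fun x hx n k => ?_⟩
  have hD : (0 : ℝ) ≤ 1 + n / q := by positivity
  have hnn : ∀ n y, 0 ≤ coverWeight ρ d p (Ico 0 1) n y := coverWeight_nonneg hp _
  have hfar : ∀ z, |z - x| ≤ 2 * ρ ^ n → coverWeight ρ d p (Ico 0 1) n z ≤
      (1 + n / q) ^ (K + K) * coverWeight ρ d p (Ico 0 1) n x := by
    intro z hz
    by_cases hz1 : z ∈ Ico (0 : ℝ) 1
    · have hmid : (z + x) / 2 ∈ Ico (0 : ℝ) 1 :=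
        ⟨by linarith [hz1.1, hx.1], by linarith [hz1.2, hx.2]⟩
      rw [abs_le] at hz
      have h1 := hK n z hz1 _ hmid (abs_le.2 ⟨by linarith, by linarith⟩)
      have h2 := hK n _ hmid x hx (abs_le.2 ⟨by linarith, by linarith⟩)
      rw [pow_add, mul_assoc]
      exact h1.trans (mul_le_mul_of_nonneg_left h2 (pow_nonneg hD K))
    · rw [coverWeight_eq_zero H.mem_Ico n hz1]
      exact mul_nonneg (pow_nonneg hD _) (hnn _ _)
  have hupper : μ.real (Metric.closedBall x (ρ ^ n)) ≤
      4 * ((1 + n / q) ^ (K + K) * coverWeight ρ d p (Ico 0 1) n x) := by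
    rw [hμ.real_closedBall hp hρ]
    refine (transfer_iterate_mono hp (real_closedBall_one_le hae) n x).trans ?_
    rw [transfer_iterate_sum]
    have : ∀ i ∈ Finset.range 4, (transfer ρ d p)^[n]
        (fun y => (Ico (0 : ℝ) 1).indicator 1 (y - ((i : ℝ) - 1))) x ≤
          (1 + n / q) ^ (K + K) * coverWeight ρ d p (Ico 0 1) n x := by
      intro i hi
      rw [transfer_iterate_translate hρ.ne']
      refine hfar _ ?_
      have hi4 : (i : ℝ) ≤ 3 := by
        have := Finset.mem_range.1 hi
        exact_mod_cast (show i ≤ 3 by omega)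
      rw [sub_sub_cancel_left, abs_neg, abs_mul, abs_of_pos (pow_pos hρ n), mul_comm]
      refine mul_le_mul_of_nonneg_right (abs_le.2 ⟨?_, by linarith⟩) (pow_pos hρ n).le
      linarith [(Nat.cast_nonneg i : (0 : ℝ) ≤ i)]
    refine (Finset.sum_le_card_nsmul _ _ _ this).trans ?_
    simp
  have hlower : coverWeight ρ d p (Ico 0 1) (n + k) x ≤
      μ.real (Metric.closedBall x (ρ ^ (n + k))) := by
    rw [hμ.real_closedBall hp hρ]
    exact transfer_iterate_mono hp (indicator_le_real_closedBall_one hae) _ _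
  calc q ^ k * μ.real (Metric.closedBall x (ρ ^ n))
      ≤ q ^ k * (4 * ((1 + n / q) ^ (K + K) * coverWeight ρ d p (Ico 0 1) n x)) :=
        mul_le_mul_of_nonneg_left hupper (pow_nonneg hq.le k)
    _ = 4 * (1 + n / q) ^ (K + K) * (q ^ k * coverWeight ρ d p (Ico 0 1) n x) := by ring
    _ ≤ _ := mul_le_mul_of_nonneg_left
        ((pow_mul_coverWeight_le H.cover_Ico hq.le hqp n k x).trans hlower) (by positivity)

end SelfSimilar

/-! ### From scales to radii -/

theorem exists_mem_Ico_abs_sub_lt {x ε : ℝ} (hx : x ∈ Icc (0 : ℝ) 1) (hε : 0 < ε) :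
    ∃ y ∈ Ico (0 : ℝ) 1, |x - y| < ε := by
  rcases hx.2.lt_or_eq with h | rfl
  · exact ⟨x, ⟨hx.1, h⟩, by simpa using hε⟩
  · have hδ : 0 < min (ε / 2) 1 := lt_min (by linarith) one_pos
    refine ⟨1 - min (ε / 2) 1, ⟨by linarith [min_le_right (ε / 2) 1], by linarith⟩, ?_⟩
    rw [sub_sub_cancel, abs_of_pos hδ]
    linarith [min_le_left (ε / 2) 1]

section Radii

variable {m : ℕ} {ρ : ℝ} {d p : Fin (m + 1) → ℝ} {μ : Measure ℝ} [IsProbabilityMeasure μ]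

theorem IsSelfSimilarMeasure.exists_real_ball_le (hμ : IsSelfSimilarMeasure ρ d p μ)
    (H : IsUnitCover ρ d) (hρ1 : ρ < 1) (hft : IsFiniteType ρ d (Icc 0 1))
    (hp1 : ∑ j, p j = 1) {q : ℝ} (hq : 0 < q) (hqp : ∀ j, q ≤ p j)
    (hql : ∀ j, d j = 0 → p j = q) (hqr : ∀ j, d j = 1 - ρ → p j = q) :
    ∃ (C s : ℝ) (K : ℕ), 0 < C ∧ ∀ x ∈ Icc (0 : ℝ) 1, ∀ r R : ℝ, 0 < r → r < R →
      R ≤ Real.exp (-1) →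
      μ.real (Metric.ball x R) ≤
        C * (-Real.log R) ^ K * (R / r) ^ s * μ.real (Metric.ball x r) := by
  obtain ⟨K, hK⟩ := hμ.exists_real_closedBall_le H hρ1 hft hp1 hq hqp hql hqr
  have hρ := H.pos
  have hq1 : q ≤ 1 := (hqp 0).trans <| hp1 ▸ Finset.single_le_sum (f := p)
    (fun j _ => hq.le.trans (hqp j)) (Finset.mem_univ 0)
  have hlρ : Real.log ρ < 0 := Real.log_neg hρ hρ1
  obtain ⟨s, hs0, hs⟩ : ∃ s : ℝ, 0 ≤ s ∧ ρ ^ s = q := by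
    refine ⟨Real.log q / Real.log ρ,
      div_nonneg_of_nonpos (Real.log_nonpos hq.le hq1) hlρ.le, ?_⟩
    rw [Real.rpow_def_of_pos hρ, mul_div_cancel₀ _ hlρ.ne, Real.exp_log hq]
  -- Chosen so that `1 + n / q ≤ A * |log R|`, from `n ≤ |log R| / |log ρ|` and `1 ≤ |log R|`.
  set A : ℝ := 1 + 1 / (q * -Real.log ρ) with hA
  have hlρ' : 0 < -Real.log ρ := neg_pos.2 hlρ
  have hA0 : 0 < A := by positivity
  refine ⟨4 * A ^ K / q ^ 2, s, K, by positivity, fun x hx r R hr hrR hR => ?_⟩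
  have hR0 : 0 < R := hr.trans hrR
  have hR1 : R < 1 := hR.trans_lt (Real.exp_lt_one_iff.2 (by norm_num))
  have hL : 1 ≤ -Real.log R := by
    have := (Real.log_le_iff_le_exp hR0).2 hR
    linarith
  -- The strict bounds `R < ρ ^ n` and, below, `ρ ^ (N + 1) < r` leave room to move the centre from
  -- `x` to some `y < 1`; this matters when `x = 1`.
  obtain ⟨n, hn1, hn2⟩ : ∃ n : ℕ, ρ ^ (n + 1) ≤ R ∧ R < ρ ^ n := by
    classical
    have hex : ∃ n : ℕ, ρ ^ n ≤ R := (exists_pow_lt_of_lt_one hR0 hρ1).imp fun _ h => h.le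
    obtain ⟨n, hn⟩ : ∃ n, Nat.find hex = n + 1 := Nat.exists_eq_succ_of_ne_zero fun h0 => by
      have := Nat.find_spec hex
      rw [h0, pow_zero] at this
      linarith
    refine ⟨n, hn ▸ Nat.find_spec hex, not_le.1 (Nat.find_min hex (by omega))⟩
  obtain ⟨N, hN1, hN2⟩ := exists_nat_pow_near_of_lt_one hr (hrR.trans hR1).le hρ hρ1
  have hnN : n < N + 1 :=
    (pow_lt_pow_iff_right_of_lt_one₀ hρ hρ1).1 (hN1.trans (hrR.trans hn2))
  obtain ⟨k, hk⟩ : ∃ k, N + 1 = n + k := ⟨N + 1 - n, by omega⟩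
  obtain ⟨y, hy, hxy⟩ := exists_mem_Ico_abs_sub_lt hx
    (lt_min (sub_pos.2 hn2) (sub_pos.2 hN1))
  have hxy1 := hxy.trans_le (min_le_left _ _)
  have hxy2 := hxy.trans_le (min_le_right _ _)
  have hbig : μ.real (Metric.ball x R) ≤ μ.real (Metric.closedBall y (ρ ^ n)) :=
    measureReal_mono <| Metric.ball_subset_closedBall.trans <|
      Metric.closedBall_subset_closedBall' (by rw [Real.dist_eq]; linarith)
  have hsmall : μ.real (Metric.closedBall y (ρ ^ (n + k))) ≤ μ.real (Metric.ball x r) := by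
    refine measureReal_mono (Metric.closedBall_subset_ball' ?_)
    rw [← hk, dist_comm, Real.dist_eq]
    linarith
  have hD : 1 + n / q ≤ A * -Real.log R := by
    have hlog : (n : ℝ) * -Real.log ρ ≤ -Real.log R := by
      have := Real.log_le_log hR0 hn2.le
      rw [Real.log_pow] at this
      linarith
    have : (n : ℝ) / q ≤ 1 / (q * -Real.log ρ) * -Real.log R := by
      rw [one_div_mul_eq_div, div_le_div_iff₀ hq (by positivity)]
      calc (n : ℝ) * (q * -Real.log ρ) = q * (n * -Real.log ρ) := by ring
        _ ≤ q * -Real.log R := mul_le_mul_of_nonneg_left hlog hq.le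
        _ = _ := mul_comm _ _
    rw [hA, add_mul, one_mul]
    linarith
  -- Rounding `R` and `r` to powers of `ρ` loses at most one scale each; raising to the power `s`
  -- turns `ρ` into `q`.
  have hqk : q ^ 2 ≤ q ^ k * (R / r) ^ s := by
    have h1 : ρ ^ 2 ≤ ρ ^ k * (R / r) := by
      rw [mul_div_assoc', le_div_iff₀ hr]
      have h2 : ρ ^ n * (ρ ^ 2 * r) ≤ ρ ^ n * (ρ ^ k * R) := by
        calc ρ ^ n * (ρ ^ 2 * r) = ρ * (ρ ^ (n + 1) * r) := by ring
          _ ≤ ρ * (R * ρ ^ N) := by gcongr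
          _ = ρ ^ (N + 1) * R := by ring
          _ = ρ ^ n * (ρ ^ k * R) := by rw [hk, pow_add]; ring
      exact le_of_mul_le_mul_left h2 (pow_pos hρ n)
    have h3 := Real.rpow_le_rpow (by positivity) h1 hs0
    rw [Real.mul_rpow (by positivity) (by positivity), ← Real.rpow_natCast_mul hρ.le,
      ← Real.rpow_natCast_mul hρ.le, mul_comm _ s, mul_comm _ s, Real.rpow_mul_natCast hρ.le,
      Real.rpow_mul_natCast hρ.le, hs] at h3
    exact h3
  have hmain : q ^ k * μ.real (Metric.ball x R) ≤
      4 * (A * -Real.log R) ^ K * μ.real (Metric.ball x r) := by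
    refine (mul_le_mul_of_nonneg_left hbig (pow_nonneg hq.le k)).trans ((hK y hy n k).trans ?_)
    have : (0 : ℝ) ≤ 1 + n / q := by positivity
    gcongr
  have hRr : 0 ≤ (R / r) ^ s := Real.rpow_nonneg (div_pos hR0 hr).le s
  have : q ^ 2 * μ.real (Metric.ball x R) ≤
      4 * (A * -Real.log R) ^ K * (R / r) ^ s * μ.real (Metric.ball x r) :=
    calc q ^ 2 * μ.real (Metric.ball x R)
        ≤ q ^ k * (R / r) ^ s * μ.real (Metric.ball x R) :=
          mul_le_mul_of_nonneg_right hqk measureReal_nonneg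
      _ = (R / r) ^ s * (q ^ k * μ.real (Metric.ball x R)) := by ring
      _ ≤ (R / r) ^ s * (4 * (A * -Real.log R) ^ K * μ.real (Metric.ball x r)) :=
          mul_le_mul_of_nonneg_left hmain hRr
      _ = _ := by ring
  calc μ.real (Metric.ball x R)
      ≤ 4 * (A * -Real.log R) ^ K * (R / r) ^ s * μ.real (Metric.ball x r) / q ^ 2 :=
        (le_div_iff₀ (by positivity)).2 (by rwa [mul_comm])
    _ = _ := by rw [mul_pow]; ring

end Radii

/-! ### Upper dimensions -/

section Dimension

variable {X : Type*} [PseudoMetricSpace X] [MeasurableSpace X] {μ : Measure X}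

/-- Since `r < R ^ (1 + Φ R)`, the exponential in `hΦ` is at most `(R / r) ^ β`, which absorbs the
logarithmic factor. -/
theorem add_mem_upperPhiExponents {C s β B : ℝ} {K : ℕ} (hC : 0 < C) (hβ : 0 ≤ β) (hB : 0 < B)
    (h : ∀ x ∈ μ.support, ∀ r R : ℝ, 0 < r → r < R → R ≤ Real.exp (-1) →
      μ.real (Metric.ball x R) ≤
        C * (-Real.log R) ^ K * (R / r) ^ s * μ.real (Metric.ball x r))
    {Φ : ℝ → ℝ} (hΦ : ∀ R : ℝ, 0 < R → R ≤ Real.exp (-1) →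
      (-Real.log R) ^ K ≤ B * Real.exp (β * (Φ R * -Real.log R))) :
    s + β ∈ upperPhiExponents Φ μ := by
  refine ⟨Real.exp (-1), C * B, Real.exp_pos _, by positivity,
    fun r R hr hrR hRR hR hR1 x hx => ?_⟩
  have hR0 := hR.1
  have hpos : 0 < R / r := div_pos hR0 hr
  have hlog : Φ R * -Real.log R ≤ Real.log (R / r) := by
    have := Real.log_le_log hr hrR.le
    rw [Real.log_rpow hR0] at this
    rw [Real.log_div hR0.ne' hr.ne']
    linarith
  have hlogK : (-Real.log R) ^ K ≤ B * (R / r) ^ β := by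
    refine (hΦ R hR0 hR1).trans (mul_le_mul_of_nonneg_left ?_ hB.le)
    rw [Real.rpow_def_of_pos hpos, mul_comm _ β]
    exact Real.exp_le_exp.2 (mul_le_mul_of_nonneg_left hlog hβ)
  have hbound : C * (-Real.log R) ^ K * (R / r) ^ s ≤ C * B * (R / r) ^ (s + β) := by
    rw [Real.rpow_add hpos]
    calc C * (-Real.log R) ^ K * (R / r) ^ s ≤ C * (B * (R / r) ^ β) * (R / r) ^ s := by
          gcongr
      _ = _ := by ring
  exact div_le_of_le_mul₀ measureReal_nonneg (by positivity)
    ((h x hx r R hr (hrR.trans_le hRR) hR1).trans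
      (mul_le_mul_of_nonneg_right hbound measureReal_nonneg))

/-- For fixed `R` the ratio of masses is at least 1, but a negative exponent would send the bound to
0 as `r` tends to 0. -/
theorem nonneg_of_mem_upperPhiExponents [IsFiniteMeasure μ] (hμ : μ.support.Nonempty) {Φ : ℝ → ℝ}
    (hΦ : ∀ x ∈ Ioo (0 : ℝ) 1, 0 ≤ Φ x) {α : ℝ} (hα : α ∈ upperPhiExponents Φ μ) : 0 ≤ α := by
  obtain ⟨C₁, C₂, hC₁, hC₂, h⟩ := hα
  obtain ⟨x, hx⟩ := hμ
  by_contra hneg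
  obtain ⟨R, hR0, hRC, hR1⟩ : ∃ R : ℝ, 0 < R ∧ R ≤ C₁ ∧ R < 1 :=
    ⟨min C₁ (1 / 2), lt_min hC₁ (by norm_num), min_le_left _ _,
      (min_le_right _ _).trans_lt (by norm_num)⟩
  have hRle : R ^ (1 + Φ R) ≤ R := by
    conv_rhs => rw [← Real.rpow_one R]
    exact Real.rpow_le_rpow_of_exponent_ge hR0 hR1.le (by linarith [hΦ R ⟨hR0, hR1⟩])
  have hge : ∀ r : ℝ, 0 < r → r < R ^ (1 + Φ R) → 1 ≤ C₂ * (R / r) ^ α := fun r hr hrR => by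
    refine le_trans ?_ (h r R hr hrR hRle ⟨hR0, hR1⟩ hRC x hx)
    have hpos : 0 < μ.real (Metric.ball x r) := ENNReal.toReal_pos
      ((Measure.mem_support_iff_forall x).1 hx _ (Metric.ball_mem_nhds x hr)).ne'
      (measure_ne_top _ _)
    rw [one_le_div hpos]
    exact measureReal_mono (Metric.ball_subset_ball (hrR.le.trans hRle))
  have hlim : Tendsto (fun r : ℝ => C₂ * (R / r) ^ α) (𝓝[>] 0) (𝓝 0) := by
    have h1 : Tendsto (fun r : ℝ => R / r) (𝓝[>] 0) atTop := by
      simpa only [div_eq_mul_inv] using tendsto_inv_nhdsGT_zero.const_mul_atTop hR0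
    have h2 := ((tendsto_rpow_neg_atTop (neg_pos.2 (not_le.1 hneg))).comp h1).const_mul C₂
    simpa [Function.comp_def] using h2
  have hev := (hlim.eventually (gt_mem_nhds one_pos)).and
    (Ioo_mem_nhdsGT (Real.rpow_pos_of_pos hR0 (1 + Φ R)))
  obtain ⟨r, hr1, hr2⟩ := hev.exists
  exact absurd (hge r hr2.1 hr2.2) (not_le.2 hr1)

theorem upperPhiDim_nonneg [IsFiniteMeasure μ] (hμ : μ.support.Nonempty) {Φ : ℝ → ℝ}
    (hΦ : ∀ x ∈ Ioo (0 : ℝ) 1, 0 ≤ Φ x) : 0 ≤ upperPhiDim Φ μ := by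
  refine le_sInf ?_
  rintro _ ⟨α, hα, rfl⟩
  exact EReal.coe_nonneg.2 (nonneg_of_mem_upperPhiExponents hμ hΦ hα)

theorem upperPhiDim_le {Φ : ℝ → ℝ} {α : ℝ} (hα : α ∈ upperPhiExponents Φ μ) :
    upperPhiDim Φ μ ≤ α :=
  sInf_le ⟨α, hα, rfl⟩

theorem upperPhiDim_anti {Φ Ψ : ℝ → ℝ} (hΦ : ∀ x ∈ Ioo (0 : ℝ) 1, 0 ≤ Φ x)
    (h : ∀ x ∈ Ioo (0 : ℝ) 1, Φ x ≤ Ψ x) : upperPhiDim Ψ μ ≤ upperPhiDim Φ μ := by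
  refine sInf_le_sInf (image_mono ?_)
  rintro α ⟨C₁, C₂, hC₁, hC₂, hα⟩
  refine ⟨C₁, C₂, hC₁, hC₂, fun r R hr hrR _ hR hRC => hα r R hr ?_ ?_ hR hRC⟩
  · exact hrR.trans_le
      (Real.rpow_le_rpow_of_exponent_ge hR.1 hR.2.le (by linarith [h R hR]))
  · conv_rhs => rw [← Real.rpow_one R]
    exact Real.rpow_le_rpow_of_exponent_ge hR.1 hR.2.le (by linarith [hΦ R hR])

end Dimension

/-! ### Absorbing the logarithmic factor, and finiteness of the dimensions -/

theorem exists_coe_of_nonneg_of_le {a : EReal} {b : ℝ} (h0 : 0 ≤ a) (h1 : a ≤ b) :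
    ∃ t : ℝ, a = t :=
  ⟨a.toReal, (EReal.coe_toReal (h1.trans_lt (EReal.coe_lt_top b)).ne
    ((EReal.bot_lt_zero).trans_le h0).ne').symm⟩

theorem pow_le_exp_of_log_div_le {c L φ : ℝ} (hL : 1 ≤ L) (K : ℕ)
    (h : Real.log L / L ≤ c * φ) : L ^ K ≤ 1 * Real.exp (c * K * (φ * L)) := by
  have hL0 : 0 < L := by linarith
  rw [div_le_iff₀ hL0] at h
  rw [one_mul, ← Real.log_le_iff_le_exp (pow_pos hL0 K), Real.log_pow]
  calc (K : ℝ) * Real.log L ≤ K * (c * φ * L) := mul_le_mul_of_nonneg_left h (Nat.cast_nonneg K)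
    _ = _ := by ring

theorem exists_pow_le_exp {ε : ℝ} (hε : 0 < ε) (K : ℕ) :
    ∃ B : ℝ, 0 < B ∧ ∀ L : ℝ, 0 ≤ L → L ^ K ≤ B * Real.exp (1 * (ε * L)) := by
  have hK : (0 : ℝ) < K.factorial := by exact_mod_cast K.factorial_pos
  refine ⟨K.factorial / ε ^ K, by positivity, fun L hL => ?_⟩
  have := Real.pow_div_factorial_le_exp (ε * L) (by positivity) K
  rw [div_le_iff₀ hK, mul_pow] at this
  rw [one_mul, div_mul_eq_mul_div, le_div_iff₀ (by positivity)]
  linarith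

end PhiDim

theorem mainTheorem11 (m : ℕ) (hm : 1 ≤ m) (ρ : ℝ) (hρ0 : 0 < ρ) (hρ1 : ρ < 1)
    (d : Fin (m + 1) → ℝ) (hd : Function.Injective d)
    (hK : PhiDim.IsSelfSimilarSet ρ d (Icc 0 1))
    (hft : PhiDim.IsFiniteType ρ d (Icc 0 1))
    (p : Fin (m + 1) → ℝ) (hp : ∀ j, 0 < p j) (hp1 : ∑ j, p j = 1)
    (hreg : PhiDim.IsRegular d p)
    (μ : Measure ℝ) [IsProbabilityMeasure μ] (hμ : PhiDim.IsSelfSimilarMeasure ρ d p μ) :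
    (∀ Φ : ℝ → ℝ, PhiDim.IsDimensionFunction Φ →
      PhiDim.DominatedOn (fun x => Real.log |Real.log x| / |Real.log x|) Φ (Ioo 0 1) →
      ∃ t : ℝ, PhiDim.upperPhiDim Φ μ = (t : EReal)) ∧
    ∃ t : ℝ, PhiDim.HasQuasiAssouadDim μ (t : EReal) := by
  have H := PhiDim.IsUnitCover.of_isSelfSimilarSet hρ0 hd hK
  obtain ⟨a, b, ha, hb, hab, hmin⟩ := hreg
  have hleft : ∀ j, d j = 0 → p j = p a := fun j hj => by
    rw [H.injective (le_antisymm (hj.le.trans (H.nonneg a)) (ha j))]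
  have hright : ∀ j, d j = 1 - ρ → p j = p a := fun j hj => by
    rw [hab, H.injective (le_antisymm (hb j) ((H.le b).trans hj.ge))]
  obtain ⟨C, s, K, hC, hball⟩ := hμ.exists_real_ball_le H hρ1 hft hp1 (hp a) hmin hleft hright
  have hsupp : μ.support ⊆ Icc 0 1 := Measure.support_subset_of_isClosed isClosed_Icc
    (hμ.ae_mem_Icc (fun j => (hp j).le) hp1 H hρ1)
  replace hball := fun x hx => hball x (hsupp hx)
  have hne : μ.support.Nonempty := Measure.nonempty_support (IsProbabilityMeasure.ne_zero μ)
  have hlog : ∀ R : ℝ, 0 < R → R ≤ Real.exp (-1) → 1 ≤ -Real.log R := fun R hR hR1 => by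
    have := (Real.log_le_iff_le_exp hR).2 hR1
    linarith
  constructor
  · rintro Φ hΦ ⟨c, hc, hdom⟩
    refine PhiDim.exists_coe_of_nonneg_of_le (PhiDim.upperPhiDim_nonneg hne hΦ.nonneg)
      (PhiDim.upperPhiDim_le (PhiDim.add_mem_upperPhiExponents (β := c * K) hC (by positivity)
        one_pos hball fun R hR hR1 => ?_))
    have hL := hlog R hR hR1
    have := hdom R ⟨hR, hR1.trans_lt (Real.exp_lt_one_iff.2 (by norm_num))⟩
    simp only [abs_of_neg (show Real.log R < 0 by linarith)] at this
    exact PhiDim.pow_le_exp_of_log_div_le hL K this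
  · have hpos : ∀ θ ∈ Ioo (0 : ℝ) 1, 0 < 1 / θ - 1 := fun θ hθ =>
      sub_pos.2 ((one_lt_div hθ.1).2 hθ.2)
    -- The constant `B` depends on `θ`, but the exponent `s + 1` does not.
    have hle : ∀ θ ∈ Ioo (0 : ℝ) 1, PhiDim.upperPhiDim (fun _ => 1 / θ - 1) μ ≤ (s + 1 : ℝ) := by
      intro θ hθ
      obtain ⟨B, hB, hB'⟩ := PhiDim.exists_pow_le_exp (hpos θ hθ) K
      exact PhiDim.upperPhiDim_le (PhiDim.add_mem_upperPhiExponents hC zero_le_one hB hball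
        fun R hR hR1 => hB' _ (zero_le_one.trans (hlog R hR hR1)))
    have hmono : MonotoneOn (fun θ : ℝ => PhiDim.upperPhiDim (fun _ => 1 / θ - 1) μ)
        (Ioo 0 1) := fun θ hθ θ' hθ' hθθ' =>
      PhiDim.upperPhiDim_anti (fun _ _ => (hpos θ' hθ').le)
        fun _ _ => sub_le_sub_right (one_div_le_one_div_of_le hθ.1 hθθ') 1
    -- A larger `θ` means a smaller Φ, hence a larger dimension; the left limit at 1 is the
    -- supremum.
    have hlim := hmono.tendsto_nhdsWithin_Ioo_left ⟨1 / 2, by norm_num, by norm_num⟩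
      (OrderTop.bddAbove _)
    have hhalf : (1 / 2 : ℝ) ∈ Ioo (0 : ℝ) 1 := ⟨by norm_num, by norm_num⟩
    obtain ⟨t, ht⟩ := PhiDim.exists_coe_of_nonneg_of_le (b := s + 1)
      (a := sSup ((fun θ : ℝ => PhiDim.upperPhiDim (fun _ => 1 / θ - 1) μ) '' Ioo 0 1))
      ((PhiDim.upperPhiDim_nonneg hne fun _ _ => (hpos _ hhalf).le).trans
        (le_sSup (mem_image_of_mem _ hhalf)))
      (sSup_le (by rintro _ ⟨θ, hθ, rfl⟩; exact hle θ hθ))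
    exact ⟨t, by rw [PhiDim.HasQuasiAssouadDim, ← ht]; exact hlim⟩
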